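/- A weighted digraph $G^W$ is a finite digraph $G=(V,E)$ with a function $W:E\to\mathbb R$ (weights may be zero or negative). If $G$ is strongly connected, its distance matrix is $D=D(G^W)=[d_{xy}]_{x,y\in V}$, where $d_{xx}=0$ and $d_{xy}$ is the minimum total weight of a directed path (without repeated vertices) from $x$ to $y$. For a square matrix $A$, $\operatorname{cof}A$ denotes the sum of all cofactors $(-1)^{i+j}\det A(i\mid j)$ of $A$, where $A(i\mid j)$ is $A$ with row $i$ and column $j$ deleted. A block of $G$ is a maximal connected subgraph without cut-vertex, where connectedness and cut-vertices refer to the underlying undirected graph. For $n,r\ge 1$ and $m_1,\dots,m_r\ge 1$, let $dC(n;m_1,\dots,m_r)$ be the digraph that consists of a directed path $u_0\to u_1\to\cdots\to u_n$ and, for each $1\le j\le r$, a directed path $u_n\to v^{(j)}_1\to\cdots\to v^{(j)}_{m_j}\to u_0$, all the vertices $u_i$, $v^{(j)}_k$ being distinct. A (nonempty) strongly connected digraph is called cactoid-type if each of its blocks is isomorphic to some $dC(n;m_1,\dots,m_r)$ with $n,r\ge1$ and all $m_j\ge1$. **Theorem.** Let $G=(V,E)$ be a cactoid-type digraph with blocks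 $G_1,\dots,G_b$, and let $W:E\to\mathbb R$ be a weight function. Let $D$ be the distance matrix of $G^W$ and, for $1\le t\le b$, let $D_t$ be the distance matrix of the block $G_t$ with the restricted weights. If $\operatorname{cof}D_t\ne0$ for all $1\le t\le b$, then $$\det D=\lambda\prod_{t=1}^{b}\operatorname{cof}D_t=\lambda\operatorname{cof}D,\qquad\text{where}\quad \lambda=\sum_{t=1}^{b}\lambda_t,\quad \lambda_t=\frac{\det D_t}{\operatorname{cof}D_t}.$$ -/

import Mathlib

namespace Cactoid

/-! ### Directed paths and distance matrices of weighted digraphs -/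

/-- `l` is the vertex sequence of a directed path of `G` from `x` to `y`: consecutive vertices
are joined by directed edges and no vertex is repeated. The one-term sequence is the path of
length zero. -/
structure IsDirPath {V : Type*} (G : Digraph V) (l : List V) (x y : V) : Prop where
  head_eq : l.head? = some x
  last_eq : l.getLast? = some y
  chain : l.IsChain G.Adj
  nodup : l.Nodup

/-- The total weight of a path: the sum of the weights `W u v` of the edges `u → v` between
consecutive vertices. -/
def pathWeight {V : Type*} (W : V → V → ℝ) : List V → ℝ
  | [] => 0
  | [_] => 0
  | u :: v :: l => W u v + pathWeight W (v :: l)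

/-- A digraph is strongly connected if it is nonempty and there is a directed path from every
vertex to every vertex. -/
def StronglyConnected {V : Type*} (G : Digraph V) : Prop :=
  Nonempty V ∧ ∀ x y : V, ∃ l : List V, IsDirPath G l x y

/-- The distance matrix of the weighted digraph `(G, W)`: its `(x, y)` entry is the minimum total
weight of a directed path from `x` to `y`. (A finite digraph has finitely many directed paths, so
the infimum is a minimum as soon as there is a path; the only path from `x` to `x` has length zero,
so diagonal entries vanish.) The weight function is only ever evaluated on edges of `G`. -/
noncomputable def distMatrix {V : Type*} (G : Digraph V) (W : V → V → ℝ) : Matrix V V ℝ :=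
  Matrix.of fun x y => sInf {w : ℝ | ∃ l : List V, IsDirPath G l x y ∧ pathWeight W l = w}

/-- The sum of all cofactors of a square matrix; the `(i, j)` cofactor is the `(j, i)` entry of
the adjugate. -/
def cof {ι : Type*} [Fintype ι] [DecidableEq ι] (A : Matrix ι ι ℝ) : ℝ :=
  ∑ i, ∑ j, A.adjugate j i

/-! ### Blocks -/

/-- The subgraph of `G` induced on a finite set `B` of vertices. -/
def induced {V : Type*} (G : Digraph V) (B : Finset V) : Digraph B where
  Adj u v := G.Adj u v

/-- The restriction of a weight function to a finite set `B` of vertices. -/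
def restrictWeight {V : Type*} (W : V → V → ℝ) (B : Finset V) : B → B → ℝ :=
  fun u v => W u v

/-- The subgraph of `G` induced on `B` is connected (forgetting orientations) and has no
cut-vertex, a cut-vertex being a vertex whose deletion leaves a disconnected graph. -/
def ConnectedNoCutVertex {V : Type*} (G : Digraph V) (B : Finset V) : Prop :=
  (G.toSimpleGraphInclusive.induce (B : Set V)).Connected ∧
    ∀ v ∈ B, (G.toSimpleGraphInclusive.induce ((B : Set V) \ {v})).Preconnected

/-- `B` is the vertex set of a block of `G`, that is, of a maximal connected subgraph without
cut-vertex. (Adding edges creates no cut-vertex, so such a maximal subgraph is the induced subgraph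
on its vertex set.) -/
def IsBlock {V : Type*} (G : Digraph V) (B : Finset V) : Prop :=
  Maximal (ConnectedNoCutVertex G) B

open scoped Classical in
/-- The finite set of the (vertex sets of the) blocks of `G`. -/
noncomputable def blocks {V : Type*} [Fintype V] (G : Digraph V) : Finset (Finset V) :=
  Finset.univ.filter (IsBlock G)

/-! ### Cactoid-type digraphs -/

/-- The digraph `dC(n; m₁, …, m_r)`: a common directed path `u₀ → u₁ → ⋯ → u_n` together with, for
each `j`, a directed path `u_n → v₁⁽ʲ⁾ → ⋯ → v_{m_j}⁽ʲ⁾ → u₀` through `m_j` new vertices. The vertex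
`u_i` is `Sum.inl i`, and `v_{k+1}⁽ʲ⁾` is `Sum.inr ⟨j, k⟩`. Meaningful when every `m_j` is positive. -/
def dC (n : ℕ) {r : ℕ} (m : Fin r → ℕ) : Digraph (Fin (n + 1) ⊕ (Σ j : Fin r, Fin (m j))) where
  Adj
    | .inl i, .inl i' => (i' : ℕ) = i + 1
    | .inl i, .inr v => (i : ℕ) = n ∧ (v.2 : ℕ) = 0
    | .inr v, .inl i => (v.2 : ℕ) + 1 = m v.1 ∧ (i : ℕ) = 0
    | .inr v, .inr v' => v.1 = v'.1 ∧ (v'.2 : ℕ) = v.2 + 1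

/-- A strongly connected digraph is cactoid-type if each of its blocks is (isomorphic to) a digraph
`dC(n; m₁, …, m_r)` with `n, r ≥ 1` and all `m_j ≥ 1`. -/
def IsCactoidType {V : Type*} (G : Digraph V) : Prop :=
  StronglyConnected G ∧
    ∀ B : Finset V, IsBlock G B →
      ∃ (n r : ℕ) (m : Fin r → ℕ), 1 ≤ n ∧ 1 ≤ r ∧ (∀ j, 1 ≤ m j) ∧
        Nonempty ((induced G B).Adj ≃r (dC n m).Adj)

/-- The distance matrix `D_t` of the weighted block with vertex set `B`; distances are measured
inside the block. -/
noncomputable def blockMatrix {V : Type*} (G : Digraph V) (W : V → V → ℝ) (B : Finset V) :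
    Matrix B B ℝ :=
  distMatrix (induced G B) (restrictWeight W B)

/-- `λ = ∑_t det D_t / cof D_t`, the sum running over the blocks of `G`. -/
noncomputable def lam {V : Type*} [Fintype V] [DecidableEq V] (G : Digraph V) (W : V → V → ℝ) : ℝ :=
  ∑ B ∈ blocks G, (blockMatrix G W B).det / cof (blockMatrix G W B)

end Cactoid

namespace Cactoid

open Matrix

/-! ### Cofactor sums and determinants of bordered matrices -/

/-! This is the Graham–Hoffman–Hosoya argument, run on induced subgraphs by strong induction on the
vertex set `S`. If `S` is not itself a block, a cut-vertex `c` splits it into `S₁` and `S₂` meeting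
only in `c` (`exists_isSeparation`). A path from `S₁` to `S₂` passes through `c`, and two paths
glued at `c` never repeat a vertex. So cross distances are sums through `c`, whatever the signs of
the weights, and distances within a side do not see the other side.

Subtracting the row and column of `c` leaves a zero corner bordering a block-diagonal core. The
determinant of the core is `cof D` (`cof_eq_det_reduced`), so `cof` is multiplicative. Linearity in
the border row gives `det D = det D₁ * cof D₂ + det D₂ * cof D₁` (`cof_det_of_glue`). Hence `det /
cof` is additive over the two sides. It remains to see that the blocks of `S` are the disjoint union
of those of `S₁` and `S₂`. -/

theorem cof_eq_sum_det_updateRow {ι : Type*} [Fintype ι] [DecidableEq ι] (A : Matrix ι ι ℝ) :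
    cof A = ∑ i, (A.updateRow i 1).det := by
  refine Finset.sum_congr rfl fun i _ => ?_
  rw [← cramer_transpose_apply, cramer_eq_adjugate_mulVec, ← adjugate_transpose]
  simp [mulVec, dotProduct]

theorem cof_submatrix_equiv {ι κ : Type*} [Fintype ι] [DecidableEq ι] [Fintype κ] [DecidableEq κ]
    (e : κ ≃ ι) (A : Matrix ι ι ℝ) : cof (A.submatrix e e) = cof A := by
  unfold cof
  rw [adjugate_submatrix_equiv_self, ← e.sum_comp]
  refine Finset.sum_congr rfl fun i _ => ?_
  rw [← e.sum_comp]
  rfl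

/-- The all-ones row is added to one row at a time, by multilinearity; the full set of rows then
gives `det (A + J) = det A + cof A`, with `J` the all-ones matrix. -/
theorem det_add_one_rows {ι : Type*} [Fintype ι] [DecidableEq ι] (A : Matrix ι ι ℝ)
    (s : Finset ι) :
    (Matrix.of fun i j => A i j + if i ∈ s then 1 else 0).det =
      A.det + ∑ i ∈ s, (A.updateRow i 1).det := by
  induction s using Finset.induction_on with
  | empty => simp; rfl
  | insert a s ha ih =>
    set M : Matrix ι ι ℝ := Matrix.of fun i j => A i j + if i ∈ s then 1 else 0 with hM
    have h1 : (Matrix.of fun i j => A i j + if i ∈ insert a s then 1 else 0) =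
        M.updateRow a (A a + 1) := by
      ext i j
      by_cases h : i = a
      · subst h; simp
      · simp [hM, h]
    have h2 : M.updateRow a (A a) = M := by
      ext i j
      by_cases h : i = a
      · subst h; simp [hM, ha]
      · simp [h]
    -- Once row `a` consists of ones, subtracting it undoes the ones already added to the rows in
    -- `s`.
    have h3 : (M.updateRow a 1).det = (A.updateRow a 1).det := by
      refine det_eq_of_forall_row_eq_smul_add_const (fun i => if i ∈ s then 1 else 0) a
        (by simp [ha]) fun i j => ?_
      by_cases h : i = a
      · subst h; simp [ha]
      · simp [hM, h]
    rw [h1, det_updateRow_add, h2, h3, ih, Finset.sum_insert ha]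
    ring

theorem det_add_const_one {ι : Type*} [Fintype ι] [DecidableEq ι] (A : Matrix ι ι ℝ) :
    (Matrix.of fun i j => A i j + 1).det = A.det + cof A := by
  have := det_add_one_rows A Finset.univ
  simpa [cof_eq_sum_det_updateRow] using this

/-- The matrix `M` bordered by the corner `t`, the first row `b` and the first column `a`. -/
def bordered {α : Type*} (t : ℝ) (b a : α → ℝ) (M : Matrix α α ℝ) :
    Matrix (Unit ⊕ α) (Unit ⊕ α) ℝ :=
  fromBlocks (of fun _ _ => t) (of fun _ y => b y) (of fun x _ => a x) M

/-! ### Bordered determinants and gluing at a base point -/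

section Bordered

variable {α β : Type*} [Fintype α] [DecidableEq α] [Fintype β] [DecidableEq β]

theorem det_bordered_add (t t' : ℝ) (b b' a : α → ℝ) (M : Matrix α α ℝ) :
    (bordered (t + t') (b + b') a M).det =
      (bordered t b a M).det + (bordered t' b' a M).det := by
  have key : ∀ (s : ℝ) (c : α → ℝ), bordered s c a M =
      (bordered 0 0 a M).updateRow (Sum.inl ()) (Sum.elim (fun _ => s) c) := by
    intro s c
    ext (i | i) (j | j) <;> simp [bordered]
  rw [key (t + t'), key t, key t', ← det_updateRow_add]
  congr 2
  ext (i | i) <;> simp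

theorem det_bordered_zero_row (t : ℝ) (a : α → ℝ) (M : Matrix α α ℝ) :
    (bordered t 0 a M).det = t * M.det := by
  have : bordered t 0 a M = fromBlocks (of fun _ _ => t) 0 (of fun x _ => a x) M := rfl
  rw [this, det_fromBlocks_zero₁₂]
  simp

theorem det_bordered_one (b a : α → ℝ) (M : Matrix α α ℝ) :
    (bordered 1 b a M).det = (bordered 0 b a M).det + M.det := by
  have := det_bordered_add 0 1 b 0 a M
  simpa [det_bordered_zero_row] using this

/-- Subtracting the base row and the base column, up to a constant shift of the corner. -/
theorem det_eq_det_bordered (t : ℝ) (A : Matrix (Unit ⊕ α) (Unit ⊕ α) ℝ)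
    (h0 : A (Sum.inl ()) (Sum.inl ()) = 0) :
    (Matrix.of fun i j => A i j + t).det =
      (bordered t (fun y => A (Sum.inl ()) (Sum.inr y)) (fun x => A (Sum.inr x) (Sum.inl ()))
        (Matrix.of fun x y => A (Sum.inr x) (Sum.inr y) - A (Sum.inr x) (Sum.inl ())
          - A (Sum.inl ()) (Sum.inr y))).det := by
  -- `B` is what remains after subtracting the base column from the others, which confines `t` to
  -- that column. Subtracting the base row then confines it to the corner.
  set B : Matrix (Unit ⊕ α) (Unit ⊕ α) ℝ := fromBlocks (of fun _ _ => t)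
    (of fun _ y => A (Sum.inl ()) (Sum.inr y)) (of fun x _ => A (Sum.inr x) (Sum.inl ()) + t)
    (of fun x y => A (Sum.inr x) (Sum.inr y) - A (Sum.inr x) (Sum.inl ())) with hB
  have h1 : (Matrix.of fun i j => A i j + t).det = B.det := by
    rw [← det_transpose, ← det_transpose B]
    refine det_eq_of_forall_row_eq_smul_add_const (Sum.elim 0 1) (Sum.inl ()) rfl ?_
    rintro (i | i) (j | j) <;> simp [hB, h0]
    ring
  rw [h1]
  refine det_eq_of_forall_row_eq_smul_add_const (Sum.elim 0 1) (Sum.inl ()) rfl ?_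
  rintro (i | i) (j | j) <;> simp [hB, bordered]

theorem det_eq_det_bordered_zero (A : Matrix (Unit ⊕ α) (Unit ⊕ α) ℝ)
    (h0 : A (Sum.inl ()) (Sum.inl ()) = 0) :
    A.det =
      (bordered 0 (fun y => A (Sum.inl ()) (Sum.inr y)) (fun x => A (Sum.inr x) (Sum.inl ()))
        (Matrix.of fun x y => A (Sum.inr x) (Sum.inr y) - A (Sum.inr x) (Sum.inl ())
          - A (Sum.inl ()) (Sum.inr y))).det := by
  rw [← det_eq_det_bordered 0 A h0]
  congr 1
  ext
  simp

/-- After reduction, `A` and `A + J` differ only in the corner, 0 against 1, and the coefficient of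
the corner is the determinant of the core. -/
theorem cof_eq_det_reduced (A : Matrix (Unit ⊕ α) (Unit ⊕ α) ℝ)
    (h0 : A (Sum.inl ()) (Sum.inl ()) = 0) :
    cof A = (Matrix.of fun x y => A (Sum.inr x) (Sum.inr y) - A (Sum.inr x) (Sum.inl ())
          - A (Sum.inl ()) (Sum.inr y)).det := by
  have h1 := det_eq_det_bordered 1 A h0
  rw [det_add_const_one, det_bordered_one, ← det_eq_det_bordered_zero A h0] at h1
  exact add_left_cancel h1

/-- With the border row zero on `β`, reassociating the index makes the matrix block lower
triangular, so the column `a₂` has no effect. -/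
theorem det_bordered_left (t : ℝ) (b₁ a₁ : α → ℝ) (a₂ : β → ℝ) (M₁ : Matrix α α ℝ)
    (M₂ : Matrix β β ℝ) :
    (bordered t (Sum.elim b₁ 0) (Sum.elim a₁ a₂) (fromBlocks M₁ 0 0 M₂)).det =
      (bordered t b₁ a₁ M₁).det * M₂.det := by
  rw [← det_fromBlocks_zero₁₂ _ (of fun x y => Sum.elim (fun _ => a₂ x) 0 y) M₂,
    ← det_submatrix_equiv_self (Equiv.sumAssoc Unit α β)]
  congr 1
  ext ((i | i) | i) ((j | j) | j) <;> simp [bordered]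

theorem det_bordered_right (t : ℝ) (b₂ a₂ : β → ℝ) (a₁ : α → ℝ) (M₁ : Matrix α α ℝ)
    (M₂ : Matrix β β ℝ) :
    (bordered t (Sum.elim 0 b₂) (Sum.elim a₁ a₂) (fromBlocks M₁ 0 0 M₂)).det =
      (bordered t b₂ a₂ M₂).det * M₁.det := by
  rw [← det_bordered_left t b₂ a₂ a₁ M₂ M₁,
    ← det_submatrix_equiv_self ((Equiv.refl Unit).sumCongr (Equiv.sumComm β α))]
  congr 1
  ext (i | i | i) (j | j | j) <;> simp [bordered]

/-- Gluing at a base point: if every cross entry of `A` is the sum of the two entries through the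
base point `Sum.inl ()`, then the cofactor sums of the two parts multiply, and the determinants
combine accordingly. -/
theorem cof_det_of_glue (A : Matrix (Unit ⊕ (α ⊕ β)) (Unit ⊕ (α ⊕ β)) ℝ)
    (A₁ : Matrix (Unit ⊕ α) (Unit ⊕ α) ℝ) (A₂ : Matrix (Unit ⊕ β) (Unit ⊕ β) ℝ)
    (h0 : A (Sum.inl ()) (Sum.inl ()) = 0)
    (h₁ : A₁ = A.submatrix (Sum.map id Sum.inl) (Sum.map id Sum.inl))
    (h₂ : A₂ = A.submatrix (Sum.map id Sum.inr) (Sum.map id Sum.inr))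
    (h12 : ∀ x y, A (Sum.inr (Sum.inl x)) (Sum.inr (Sum.inr y)) =
      A (Sum.inr (Sum.inl x)) (Sum.inl ()) + A (Sum.inl ()) (Sum.inr (Sum.inr y)))
    (h21 : ∀ x y, A (Sum.inr (Sum.inr y)) (Sum.inr (Sum.inl x)) =
      A (Sum.inr (Sum.inr y)) (Sum.inl ()) + A (Sum.inl ()) (Sum.inr (Sum.inl x))) :
    cof A = cof A₁ * cof A₂ ∧ A.det = A₁.det * cof A₂ + A₂.det * cof A₁ := by
  have h01 : A₁ (Sum.inl ()) (Sum.inl ()) = 0 := by simp [h₁, h0]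
  have h02 : A₂ (Sum.inl ()) (Sum.inl ()) = 0 := by simp [h₂, h0]
  rw [cof_eq_det_reduced A h0, cof_eq_det_reduced A₁ h01, cof_eq_det_reduced A₂ h02,
    det_eq_det_bordered_zero A h0, det_eq_det_bordered_zero A₁ h01,
    det_eq_det_bordered_zero A₂ h02]
  set M₁ : Matrix α α ℝ := of fun x y => A₁ (Sum.inr x) (Sum.inr y) - A₁ (Sum.inr x) (Sum.inl ())
    - A₁ (Sum.inl ()) (Sum.inr y) with hM₁
  set M₂ : Matrix β β ℝ := of fun x y => A₂ (Sum.inr x) (Sum.inr y) - A₂ (Sum.inr x) (Sum.inl ())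
    - A₂ (Sum.inl ()) (Sum.inr y) with hM₂
  have hM : (of fun x y => A (Sum.inr x) (Sum.inr y) - A (Sum.inr x) (Sum.inl ())
      - A (Sum.inl ()) (Sum.inr y)) = fromBlocks M₁ 0 0 M₂ := by
    ext (x | x) (y | y)
    · simp [hM₁, h₁]
    · simp [h12]
    · simp [h21]
    · simp [hM₂, h₂]
  refine ⟨by rw [hM, det_fromBlocks_zero₁₂], ?_⟩
  -- The free columns are chosen so that both bordered matrices agree with that of `A` outside the
  -- border row; that row is the sum of its `α` and `β` parts.
  rw [hM, ← det_bordered_left 0 _ _ (fun y => A₂ (Sum.inr y) (Sum.inl ())) M₁ M₂,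
    ← det_bordered_right 0 _ _ (fun x => A₁ (Sum.inr x) (Sum.inl ())) M₁ M₂, ← det_bordered_add]
  congr 2
  · simp
  · ext (x | x) <;> simp [h₁, h₂]
  · ext (x | x) <;> simp [h₁, h₂]

end Bordered

/-! ### Distances measured inside a set of vertices -/

section PathsIn

variable {V : Type*} (G : Digraph V) (W : V → V → ℝ)

/-- `l` is a directed path of `G` from `x` to `y` all of whose vertices lie in `S`. -/
def IsPathIn (S : Finset V) (l : List V) (x y : V) : Prop :=
  IsDirPath G l x y ∧ ∀ v ∈ l, v ∈ S

/-- The set of weights of the directed paths from `x` to `y` inside `S`. -/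
def pathWeights (S : Finset V) (x y : V) : Set ℝ :=
  {w | ∃ l, IsPathIn G S l x y ∧ pathWeight W l = w}

/-- The subgraph induced on `S` is strongly connected. -/
def StronglyConnectedOn (S : Finset V) : Prop :=
  S.Nonempty ∧ ∀ x ∈ S, ∀ y ∈ S, ∃ l, IsPathIn G S l x y

variable {G W}

theorem pathWeight_map {X : Type*} (f : X → V) (l : List X) :
    pathWeight W (l.map f) = pathWeight (fun u v => W (f u) (f v)) l := by
  induction l with
  | nil => rfl
  | cons u l ih =>
    cases l with
    | nil => rfl
    | cons v l => simpa [pathWeight] using ih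

theorem pathWeight_append_cons (p q : List V) (c : V) :
    pathWeight W (p ++ c :: q) = pathWeight W (p ++ [c]) + pathWeight W (c :: q) := by
  induction p with
  | nil => simp [pathWeight]
  | cons u p ih =>
    cases p with
    | nil => simp [pathWeight]
    | cons v p =>
      simp only [List.cons_append, pathWeight] at ih ⊢
      rw [ih, add_assoc]

theorem isDirPath_induced_iff {S : Finset V} (l : List S) (x y : S) :
    IsDirPath (induced G S) l x y ↔ IsDirPath G (l.map Subtype.val) x y := by
  constructor
  · rintro ⟨h1, h2, h3, h4⟩
    refine ⟨by rw [List.head?_map, h1]; rfl, by rw [List.getLast?_map, h2]; rfl, ?_,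
      h4.map Subtype.val_injective⟩
    rw [List.isChain_map]
    exact h3
  · rintro ⟨h1, h2, h3, h4⟩
    refine ⟨?_, ?_, ?_, List.Nodup.of_map _ h4⟩
    · rw [List.head?_map] at h1
      exact Option.map_injective Subtype.val_injective h1
    · rw [List.getLast?_map] at h2
      exact Option.map_injective Subtype.val_injective h2
    · rw [List.isChain_map] at h3
      exact h3

theorem blockMatrix_apply (S : Finset V) (x y : S) :
    blockMatrix G W S x y = sInf (pathWeights G W S x y) := by
  simp only [blockMatrix, distMatrix, of_apply]
  congr 1
  ext w
  constructor
  · rintro ⟨l, hl, rfl⟩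
    refine ⟨l.map Subtype.val, ⟨(isDirPath_induced_iff l x y).1 hl, ?_⟩, pathWeight_map _ _⟩
    intro v hv
    obtain ⟨u, -, rfl⟩ := List.mem_map.1 hv
    exact u.2
  · rintro ⟨l, ⟨hl, hS⟩, rfl⟩
    lift l to List S using hS
    exact ⟨l, (isDirPath_induced_iff l x y).2 hl, (pathWeight_map Subtype.val l).symm⟩

theorem pathWeights_finite [Finite V] (S : Finset V) (x y : V) :
    (pathWeights G W S x y).Finite := by
  have : Fintype V := Fintype.ofFinite V
  classical
  have hfin : {l : List V | l.Nodup}.Finite :=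
    Set.finite_coe_iff.1 (inferInstanceAs (Finite {l : List V // l.Nodup}))
  refine (hfin.image (pathWeight W)).subset ?_
  rintro w ⟨l, hl, rfl⟩
  exact ⟨l, hl.1.nodup, rfl⟩

theorem pathWeights_self {S : Finset V} {c : V} (hc : c ∈ S) :
    pathWeights G W S c c = {0} := by
  ext w
  constructor
  · rintro ⟨l, ⟨⟨h1, h2, -, h4⟩, -⟩, rfl⟩
    obtain ⟨q, rfl⟩ := List.head?_eq_some_iff.1 h1
    cases q with
    | nil => rfl
    | cons v q =>
      rw [List.getLast?_cons_cons] at h2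
      exact absurd (List.mem_of_getLast? h2) (List.nodup_cons.1 h4).1
  · rintro rfl
    exact ⟨[c], ⟨⟨rfl, rfl, List.isChain_singleton c, List.nodup_singleton c⟩, by simpa⟩, rfl⟩

/-! ### Separations at a cut-vertex -/

variable (G) in
/-- The vertex sets `S₁` and `S₂` share exactly the vertex `c`, and every edge between them
is incident with `c`. -/
structure IsSeparation (S₁ S₂ : Finset V) (c : V) : Prop where
  mem_left : c ∈ S₁
  mem_right : c ∈ S₂
  eq_of_mem : ∀ v, v ∈ S₁ → v ∈ S₂ → v = c
  not_adj : ∀ u ∈ S₁, ∀ v ∈ S₂, u ≠ c → v ≠ c → ¬ G.Adj u v ∧ ¬ G.Adj v u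

namespace IsSeparation

variable {S₁ S₂ : Finset V} {c : V}

theorem symm (h : IsSeparation G S₁ S₂ c) : IsSeparation G S₂ S₁ c :=
  ⟨h.mem_right, h.mem_left, fun v h₂ h₁ => h.eq_of_mem v h₁ h₂,
    fun u hu v hv huc hvc => (h.not_adj v hv u hu hvc huc).symm⟩

variable [DecidableEq V]

/-- Only `c` gives passage between the sides, so a chain avoiding `c` stays on the side where it
starts. -/
theorem forall_mem_of_head (h : IsSeparation G S₁ S₂ c) {l : List V} (hl : l.IsChain G.Adj)
    (hS : ∀ v ∈ l, v ∈ S₁ ∪ S₂) (hc : c ∉ l) {x : V} (hx : l.head? = some x) (hx₁ : x ∈ S₁) :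
    ∀ v ∈ l, v ∈ S₁ := by
  induction l generalizing x with
  | nil => simp
  | cons u l ih =>
    obtain rfl : u = x := by simpa using hx
    cases l with
    | nil => simpa using hx₁
    | cons v l =>
      simp only [List.mem_cons, not_or] at hc
      rw [List.isChain_cons_cons] at hl
      have hv₁ : v ∈ S₁ := by
        rcases Finset.mem_union.1 (hS v (by simp)) with hv | hv
        · exact hv
        · exact absurd hl.1 (h.not_adj u hx₁ v hv (Ne.symm hc.1) (Ne.symm hc.2.1)).1
      have := ih hl.2 (fun w hw => hS w (List.mem_cons_of_mem _ hw)) (by simp [hc.2]) rfl hv₁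
      intro w hw
      rcases List.mem_cons.1 hw with rfl | hw
      · exact hx₁
      · exact this w hw

theorem forall_mem_of_mem (h : IsSeparation G S₁ S₂ c) {l : List V} (hl : l.IsChain G.Adj)
    (hS : ∀ v ∈ l, v ∈ S₁ ∪ S₂) (hc : c ∉ l) {x : V} (hx : x ∈ l) (hx₁ : x ∈ S₁) :
    ∀ v ∈ l, v ∈ S₁ := by
  cases l with
  | nil => simp
  | cons u l =>
    rcases Finset.mem_union.1 (hS u (by simp)) with hu | hu
    · exact h.forall_mem_of_head hl hS hc rfl hu
    · have := h.symm.forall_mem_of_head hl (by rwa [Finset.union_comm]) hc rfl hu x hx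
      exact absurd (h.eq_of_mem x hx₁ this ▸ hx) hc

/-- An excursion into `S₂` would have to visit `c` twice. Formally, the pieces before and after `c`
avoid `c` and contain `x` or `y` if nonempty, hence stay in `S₁`. -/
theorem isPathIn_left_iff (h : IsSeparation G S₁ S₂ c) {l : List V} {x y : V} (hx : x ∈ S₁)
    (hy : y ∈ S₁) : IsPathIn G (S₁ ∪ S₂) l x y ↔ IsPathIn G S₁ l x y := by
  refine ⟨fun ⟨hp, hS⟩ => ⟨hp, ?_⟩, fun ⟨hp, hS⟩ =>
    ⟨hp, fun v hv => Finset.mem_union_left _ (hS v hv)⟩⟩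
  by_cases hc : c ∈ l
  · obtain ⟨p, q, rfl⟩ := List.append_of_mem hc
    obtain ⟨h1, h2, h3, h4⟩ := hp
    rw [List.isChain_split] at h3
    have hcp : c ∉ p := fun hcp => (List.nodup_append.1 h4).2.2 c hcp c (by simp) rfl
    have hcq : c ∉ q := (List.nodup_cons.1 (List.nodup_append.1 h4).2.1).1
    intro v hv
    simp only [List.mem_append, List.mem_cons] at hv hS
    rcases hv with hv | rfl | hv
    · cases p with
      | nil => simp at hv
      | cons u p =>
        obtain rfl : u = x := by simpa using h1
        exact h.forall_mem_of_mem h3.1.left_of_append (fun w hw => hS w (Or.inl hw)) hcp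
          (by simp) hx v hv
    · exact h.mem_left
    · refine h.forall_mem_of_mem h3.2.of_cons (fun w hw => hS w (Or.inr (Or.inr hw))) hcq
        (x := y) ?_ hy v hv
      cases q with
      | nil => simp at hv
      | cons u q =>
        rw [List.getLast?_append_cons, List.getLast?_cons_cons] at h2
        exact List.mem_of_getLast? h2
  · exact h.forall_mem_of_head hp.chain hS hc hp.head_eq hx

theorem pathWeights_left (h : IsSeparation G S₁ S₂ c) {x y : V} (hx : x ∈ S₁) (hy : y ∈ S₁) :
    pathWeights G W (S₁ ∪ S₂) x y = pathWeights G W S₁ x y := by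
  simp only [pathWeights, h.isPathIn_left_iff hx hy]

theorem isPathIn_append (h : IsSeparation G S₁ S₂ c) {p q : List V} {x y : V}
    (hp : IsPathIn G S₁ (p ++ [c]) x c) (hq : IsPathIn G S₂ (c :: q) c y) :
    IsPathIn G (S₁ ∪ S₂) (p ++ c :: q) x y := by
  obtain ⟨⟨h1, -, h3, h4⟩, h5⟩ := hp
  obtain ⟨⟨-, g2, g3, g4⟩, g5⟩ := hq
  refine ⟨⟨?_, ?_, List.isChain_split.2 ⟨h3, g3⟩, ?_⟩, ?_⟩
  · cases p <;> simpa using h1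
  · rwa [List.getLast?_append_cons]
  · rw [List.nodup_append] at h4 ⊢
    refine ⟨h4.1, g4, ?_⟩
    rintro a ha b hb rfl
    exact h4.2.2 a ha c (by simp) (h.eq_of_mem a (h5 a (by simp [ha])) (g5 a hb))
  · intro v hv
    rcases List.mem_append.1 hv with hv | hv
    · exact Finset.mem_union_left _ (h5 v (by simp [hv]))
    · exact Finset.mem_union_right _ (g5 v hv)

theorem exists_append_of_isPathIn (h : IsSeparation G S₁ S₂ c) {l : List V} {x y : V}
    (hl : IsPathIn G (S₁ ∪ S₂) l x y) (hx : x ∈ S₁) (hy : y ∈ S₂) :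
    ∃ p q, l = p ++ c :: q ∧ IsPathIn G S₁ (p ++ [c]) x c ∧ IsPathIn G S₂ (c :: q) c y := by
  have hc : c ∈ l := by
    by_contra hc
    have hy' := List.mem_of_getLast? hl.1.last_eq
    have := h.forall_mem_of_head hl.1.chain hl.2 hc hl.1.head_eq hx y hy'
    exact hc (h.eq_of_mem y this hy ▸ hy')
  obtain ⟨p, q, rfl⟩ := List.append_of_mem hc
  obtain ⟨⟨h1, h2, h3, h4⟩, h5⟩ := hl
  refine ⟨p, q, rfl, ?_, ?_⟩
  · rw [← h.isPathIn_left_iff hx h.mem_left]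
    refine ⟨⟨by cases p <;> simpa using h1, by simp, (List.isChain_split.1 h3).1,
      h4.sublist ?_⟩, fun v hv => h5 v ?_⟩
    · simp
    · simp only [List.mem_append, List.mem_cons, List.not_mem_nil, or_false] at hv ⊢
      tauto
  · rw [← h.symm.isPathIn_left_iff h.mem_right hy, Finset.union_comm]
    refine ⟨⟨rfl, by rwa [List.getLast?_append_cons] at h2, (List.isChain_split.1 h3).2,
      (List.nodup_append.1 h4).2.1⟩, fun v hv => h5 v (List.mem_append_right _ hv)⟩

-- Cutting and gluing at `c` are inverse operations, so the weight sets form a Minkowski sum. Being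
-- finite and nonempty, they have infima that add.
open scoped Pointwise in
theorem pathWeights_cross (h : IsSeparation G S₁ S₂ c) {x y : V} (hx : x ∈ S₁) (hy : y ∈ S₂) :
    pathWeights G W (S₁ ∪ S₂) x y = pathWeights G W S₁ x c + pathWeights G W S₂ c y := by
  ext w
  constructor
  · rintro ⟨l, hl, rfl⟩
    obtain ⟨p, q, rfl, hp, hq⟩ := h.exists_append_of_isPathIn hl hx hy
    exact ⟨_, ⟨_, hp, rfl⟩, _, ⟨_, hq, rfl⟩, (pathWeight_append_cons p q c).symm⟩
  · rintro ⟨_, ⟨l₁, hl₁, rfl⟩, _, ⟨l₂, hl₂, rfl⟩, rfl⟩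
    obtain ⟨p, rfl⟩ := List.getLast?_eq_some_iff.1 hl₁.1.last_eq
    obtain ⟨q, rfl⟩ := List.head?_eq_some_iff.1 hl₂.1.head_eq
    exact ⟨_, h.isPathIn_append hl₁ hl₂, pathWeight_append_cons p q c⟩

theorem stronglyConnectedOn_left (h : IsSeparation G S₁ S₂ c)
    (hS : StronglyConnectedOn G (S₁ ∪ S₂)) : StronglyConnectedOn G S₁ := by
  refine ⟨⟨c, h.mem_left⟩, fun x hx y hy => ?_⟩
  obtain ⟨l, hl⟩ := hS.2 x (Finset.mem_union_left _ hx) y (Finset.mem_union_left _ hy)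
  exact ⟨l, (h.isPathIn_left_iff hx hy).1 hl⟩

theorem stronglyConnectedOn_right (h : IsSeparation G S₁ S₂ c)
    (hS : StronglyConnectedOn G (S₁ ∪ S₂)) : StronglyConnectedOn G S₂ :=
  h.symm.stronglyConnectedOn_left (by rwa [Finset.union_comm])

theorem sInf_pathWeights_cross [Finite V] (h : IsSeparation G S₁ S₂ c)
    (hS : StronglyConnectedOn G (S₁ ∪ S₂)) {x y : V} (hx : x ∈ S₁) (hy : y ∈ S₂) :
    sInf (pathWeights G W (S₁ ∪ S₂) x y) =
      sInf (pathWeights G W (S₁ ∪ S₂) x c) + sInf (pathWeights G W (S₁ ∪ S₂) c y) := by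
  rw [h.pathWeights_cross hx hy, h.pathWeights_left hx h.mem_left, Finset.union_comm,
    h.symm.pathWeights_left h.mem_right hy]
  obtain ⟨l₁, hl₁⟩ := (h.stronglyConnectedOn_left hS).2 x hx c h.mem_left
  obtain ⟨l₂, hl₂⟩ := (h.stronglyConnectedOn_right hS).2 c h.mem_right y hy
  exact csInf_add ⟨_, l₁, hl₁, rfl⟩ (pathWeights_finite _ _ _).bddBelow ⟨_, l₂, hl₂, rfl⟩
    (pathWeights_finite _ _ _).bddBelow

theorem cof_det_blockMatrix [Finite V] (h : IsSeparation G S₁ S₂ c)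
    (hS : StronglyConnectedOn G (S₁ ∪ S₂)) :
    cof (blockMatrix G W (S₁ ∪ S₂)) = cof (blockMatrix G W S₁) * cof (blockMatrix G W S₂) ∧
      (blockMatrix G W (S₁ ∪ S₂)).det =
        (blockMatrix G W S₁).det * cof (blockMatrix G W S₂) +
          (blockMatrix G W S₂).det * cof (blockMatrix G W S₁) := by
  have : Fintype V := Fintype.ofFinite V
  -- Reindexing with `c` as the base point brings the matrices into the shape of `cof_det_of_glue`.
  have split : ∀ T : Finset V, c ∈ T → ∃ e : Unit ⊕ {v // v ∈ T ∧ v ≠ c} ≃ T,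
      ∀ i, (e i : V) = Sum.elim (fun _ => c) Subtype.val i := by
    intro T hT
    refine ⟨Equiv.ofBijective (Sum.elim (fun _ => ⟨c, hT⟩) fun v => ⟨v, v.2.1⟩) ⟨?_, ?_⟩, ?_⟩
    · rintro (⟨⟩ | ⟨x, hx⟩) (⟨⟩ | ⟨y, hy⟩) hxy
      · rfl
      · simp at hxy; exact absurd hxy.symm hy.2
      · simp at hxy; exact absurd hxy hx.2
      · simp at hxy; simp [hxy]
    · rintro ⟨v, hv⟩
      by_cases hvc : v = c
      · subst hvc; exact ⟨Sum.inl (), rfl⟩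
      · exact ⟨Sum.inr ⟨v, hv, hvc⟩, rfl⟩
    · rintro (⟨⟩ | ⟨x, hx⟩) <;> rfl
  obtain ⟨e₁, he₁⟩ := split S₁ h.mem_left
  obtain ⟨e₂, he₂⟩ := split S₂ h.mem_right
  have : ∃ e : Unit ⊕ ({v // v ∈ S₁ ∧ v ≠ c} ⊕ {v // v ∈ S₂ ∧ v ≠ c}) ≃ ↥(S₁ ∪ S₂),
      ∀ i, (e i : V) = Sum.elim (fun _ => c) (Sum.elim Subtype.val Subtype.val) i := by
    refine ⟨Equiv.ofBijective (Sum.elim (fun _ => ⟨c, Finset.mem_union_left _ h.mem_left⟩)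
      (Sum.elim (fun v => ⟨v, Finset.mem_union_left _ v.2.1⟩)
        fun v => ⟨v, Finset.mem_union_right _ v.2.1⟩)) ⟨?_, ?_⟩, ?_⟩
    · rintro (⟨⟩ | ⟨x, hx⟩ | ⟨x, hx⟩) (⟨⟩ | ⟨y, hy⟩ | ⟨y, hy⟩) hxy <;> simp at hxy ⊢
      · exact absurd hxy.symm hy.2
      · exact absurd hxy.symm hy.2
      · exact absurd hxy hx.2
      · exact hxy
      · exact hx.2 (h.eq_of_mem x hx.1 (hxy ▸ hy.1))
      · exact absurd hxy hx.2
      · exact hx.2 (h.eq_of_mem x (hxy ▸ hy.1) hx.1)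
      · exact hxy
    · rintro ⟨v, hv⟩
      by_cases hvc : v = c
      · subst hvc; exact ⟨Sum.inl (), rfl⟩
      · rcases Finset.mem_union.1 hv with hv | hv
        · exact ⟨Sum.inr (Sum.inl ⟨v, hv, hvc⟩), rfl⟩
        · exact ⟨Sum.inr (Sum.inr ⟨v, hv, hvc⟩), rfl⟩
    · rintro (⟨⟩ | ⟨x, hx⟩ | ⟨x, hx⟩) <;> rfl
  obtain ⟨e, he⟩ := this
  rw [← cof_submatrix_equiv e, ← cof_submatrix_equiv e₁, ← cof_submatrix_equiv e₂,
    ← det_submatrix_equiv_self e, ← det_submatrix_equiv_self e₁, ← det_submatrix_equiv_self e₂]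
  apply cof_det_of_glue
  · simp [blockMatrix_apply, he, pathWeights_self (Finset.mem_union_left S₂ h.mem_left)]
  · ext i j
    have hm : ∀ i, (e₁ i : V) = e (Sum.map id Sum.inl i) := by
      rintro (i | i) <;> simp [he, he₁]
    simp only [submatrix_apply, blockMatrix_apply, ← hm]
    rw [h.pathWeights_left (e₁ i).2 (e₁ j).2]
  · ext i j
    have hm : ∀ i, (e₂ i : V) = e (Sum.map id Sum.inr i) := by
      rintro (i | i) <;> simp [he, he₂]
    simp only [submatrix_apply, blockMatrix_apply, ← hm]
    rw [Finset.union_comm, h.symm.pathWeights_left (e₂ i).2 (e₂ j).2]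
  · intro x y
    simp only [submatrix_apply, blockMatrix_apply, he]
    exact h.sInf_pathWeights_cross hS x.2.1 y.2.1
  · intro x y
    simp only [submatrix_apply, blockMatrix_apply, he, Finset.union_comm S₁ S₂]
    exact h.symm.sInf_pathWeights_cross (by rwa [Finset.union_comm]) y.2.1 x.2.1

end IsSeparation

end PathsIn

/-! ### Blocks and cut-vertices -/

section Blocks

variable {V : Type*} {G : Digraph V} {W : V → V → ℝ}

theorem reachable_induce_of_isPathIn {S : Finset V} {l : List V} {x y : V}
    (hl : IsPathIn G S l x y) (hx : x ∈ S) (hy : y ∈ S) :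
    (G.toSimpleGraphInclusive.induce (S : Set V)).Reachable ⟨x, hx⟩ ⟨y, hy⟩ := by
  obtain ⟨⟨h1, h2, h3, h4⟩, h5⟩ := hl
  induction l generalizing x with
  | nil => simp at h1
  | cons u l ih =>
    obtain rfl : u = x := by simpa using h1
    cases l with
    | nil =>
      obtain rfl : u = y := by simpa using h2
      exact SimpleGraph.Reachable.refl _
    | cons v l =>
      rw [List.isChain_cons_cons] at h3
      rw [List.getLast?_cons_cons] at h2
      rw [List.nodup_cons] at h4
      have hv : v ∈ S := h5 v (by simp)
      refine SimpleGraph.Reachable.trans (SimpleGraph.Adj.reachable ?_)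
        (ih hv (fun w hw => h5 w (List.mem_cons_of_mem _ hw)) rfl h2 h3.2 h4.2)
      exact ⟨fun e => h4.1 (List.mem_cons.2 (Or.inl e)), Or.inl h3.1⟩

theorem StronglyConnectedOn.connected {S : Finset V} (hS : StronglyConnectedOn G S) :
    (G.toSimpleGraphInclusive.induce (S : Set V)).Connected := by
  obtain ⟨⟨v, hv⟩, hS⟩ := hS
  have : Nonempty (S : Set V) := ⟨⟨v, hv⟩⟩
  refine SimpleGraph.Connected.mk fun ⟨x, hx⟩ ⟨y, hy⟩ => ?_
  obtain ⟨l, hl⟩ := hS x hx y hy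
  exact reachable_induce_of_isPathIn hl hx hy

theorem reachable_induction {X : Type*} {H : SimpleGraph X} {P : X → Prop}
    (hP : ∀ u v, H.Adj u v → P u → P v) {x y : X} (h : H.Reachable x y) (hx : P x) : P y := by
  obtain ⟨w⟩ := h
  induction w with
  | nil => exact hx
  | cons hadj _ ih => exact ih (hP _ _ hadj hx)

theorem exists_isSeparation [DecidableEq V] {S : Finset V} (hS : StronglyConnectedOn G S)
    (hB : ¬ ConnectedNoCutVertex G S) :
    ∃ S₁ S₂ c, IsSeparation G S₁ S₂ c ∧ S₁ ∪ S₂ = S ∧ S₁ ⊂ S ∧ S₂ ⊂ S ∧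
      S₁ ≠ {c} ∧ S₂ ≠ {c} := by
  classical
  simp only [ConnectedNoCutVertex, hS.connected, true_and, not_forall] at hB
  obtain ⟨c, hc, hB⟩ := hB
  simp only [SimpleGraph.Preconnected, not_forall] at hB
  obtain ⟨x, y, hxy⟩ := hB
  set H := G.toSimpleGraphInclusive.induce ((S : Set V) \ {c}) with hH
  have hxS : (x : V) ∈ S := x.2.1
  have hyS : (y : V) ∈ S := y.2.1
  have hxc : (x : V) ≠ c := x.2.2
  have hyc : (y : V) ≠ c := y.2.2
  -- `S₁` is the component of `x` in `S` minus `c`, and `S₂` is the rest, which contains `y`; `c` is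
  -- put back into both.
  let S₁ := S.filter fun z => z = c ∨ ∃ h, H.Reachable x ⟨z, h⟩
  let S₂ := S.filter fun z => z = c ∨ ∃ h, ¬ H.Reachable x ⟨z, h⟩
  have hx₁ : (x : V) ∈ S₁ :=
    Finset.mem_filter.2 ⟨hxS, Or.inr ⟨x.2, SimpleGraph.Reachable.refl _⟩⟩
  have hy₂ : (y : V) ∈ S₂ := Finset.mem_filter.2 ⟨hyS, Or.inr ⟨y.2, hxy⟩⟩
  have hsep : ∀ v, v ∈ S₁ → v ∈ S₂ → v = c := by
    intro v h₁ h₂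
    rcases (Finset.mem_filter.1 h₁).2 with h | ⟨hv, h⟩
    · exact h
    rcases (Finset.mem_filter.1 h₂).2 with h' | ⟨hv', h'⟩
    · exact h'
    exact absurd h h'
  refine ⟨S₁, S₂, c, ⟨Finset.mem_filter.2 ⟨hc, Or.inl rfl⟩, Finset.mem_filter.2 ⟨hc, Or.inl rfl⟩,
    hsep, ?_⟩, ?_, ?_, ?_, ?_, ?_⟩
  · intro u hu v hv huc hvc
    obtain ⟨hu', hur⟩ := (Finset.mem_filter.1 hu).2.resolve_left huc
    obtain ⟨hv', hvr⟩ := (Finset.mem_filter.1 hv).2.resolve_left hvc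
    have hne : u ≠ v := by rintro rfl; exact hvr hur
    have : ¬ H.Adj ⟨u, hu'⟩ ⟨v, hv'⟩ := fun hadj => hvr (hur.trans hadj.reachable)
    exact ⟨fun hadj => this ⟨hne, Or.inl hadj⟩, fun hadj => this ⟨hne, Or.inr hadj⟩⟩
  · ext z
    refine ⟨fun hz => ?_, fun hz => ?_⟩
    · rcases Finset.mem_union.1 hz with hz | hz <;> exact (Finset.mem_filter.1 hz).1
    · by_cases hzc : z = c
      · exact Finset.mem_union_left _ (Finset.mem_filter.2 ⟨hz, Or.inl hzc⟩)
      · by_cases hr : H.Reachable x ⟨z, hz, hzc⟩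
        · exact Finset.mem_union_left _ (Finset.mem_filter.2 ⟨hz, Or.inr ⟨_, hr⟩⟩)
        · exact Finset.mem_union_right _ (Finset.mem_filter.2 ⟨hz, Or.inr ⟨_, hr⟩⟩)
  · exact Finset.filter_ssubset.2 ⟨y, hyS, fun h => hyc (hsep y (Finset.mem_filter.2 ⟨hyS, h⟩) hy₂)⟩
  · exact Finset.filter_ssubset.2 ⟨x, hxS, fun h => hxc (hsep x hx₁ (Finset.mem_filter.2 ⟨hxS, h⟩))⟩
  · intro h
    exact hxc (Finset.mem_singleton.1 (h ▸ hx₁))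
  · intro h
    exact hyc (Finset.mem_singleton.1 (h ▸ hy₂))

/-- Otherwise `B` has vertices other than `c` on both sides. But `B` without `c` is connected, and
no edge avoiding `c` joins the sides. -/
theorem IsSeparation.subset_or_subset [DecidableEq V] {S₁ S₂ B : Finset V} {c : V}
    (h : IsSeparation G S₁ S₂ c)
    (hB : ConnectedNoCutVertex G B) (hBS : B ⊆ S₁ ∪ S₂) : B ⊆ S₁ ∨ B ⊆ S₂ := by
  by_contra! hcon
  obtain ⟨⟨x, hxB, hx₁⟩, ⟨y, hyB, hy₂⟩⟩ := hcon.imp Finset.not_subset.1 Finset.not_subset.1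
  have hx₂ : x ∈ S₂ := (Finset.mem_union.1 (hBS hxB)).resolve_left hx₁
  have hy₁ : y ∈ S₁ := (Finset.mem_union.1 (hBS hyB)).resolve_right hy₂
  have hxc : x ≠ c := fun e => hx₁ (e ▸ h.mem_left)
  have hyc : y ≠ c := fun e => hy₂ (e ▸ h.mem_right)
  have hconn : (G.toSimpleGraphInclusive.induce ((B : Set V) \ {c})).Preconnected := by
    by_cases hc : c ∈ B
    · exact hB.2 c hc
    · rw [Set.sdiff_singleton_eq_self (by simpa using hc)]
      exact hB.1.preconnected
  refine hy₂ (reachable_induction (P := fun z : ↥((B : Set V) \ {c}) => (z : V) ∈ S₂) ?_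
    (hconn ⟨x, hxB, hxc⟩ ⟨y, hyB, hyc⟩) hx₂)
  rintro ⟨u, huB, huc⟩ ⟨v, hvB, hvc⟩ hadj hu
  refine (Finset.mem_union.1 (hBS hvB)).resolve_left fun hv => ?_
  have := h.not_adj v hv u hu hvc huc
  rcases hadj.2 with hadj | hadj
  · exact this.2 hadj
  · exact this.1 hadj

theorem connectedNoCutVertex_pair [DecidableEq V] {u v : V}
    (huv : G.toSimpleGraphInclusive.Adj u v) :
    ConnectedNoCutVertex G {u, v} := by
  constructor
  · rw [Finset.coe_pair]
    exact SimpleGraph.induce_pair_connected_of_adj huv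
  · intro w hw
    have : Subsingleton ↥((({u, v} : Finset V) : Set V) \ {w}) := by
      rw [Set.subsingleton_coe, Finset.coe_pair]
      rintro a ⟨ha, haw⟩ b ⟨hb, hbw⟩
      simp only [Finset.mem_insert, Finset.mem_singleton, Set.mem_insert_iff,
        Set.mem_singleton_iff] at hw ha hb haw hbw
      grind
    exact SimpleGraph.Preconnected.of_subsingleton

/-! ### Blocks of induced subgraphs -/

variable (G) in
/-- `B` is the vertex set of a block of the subgraph induced on `S`. -/
def IsBlockOf (S B : Finset V) : Prop :=
  Maximal (fun B => ConnectedNoCutVertex G B ∧ B ⊆ S) B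

/-- The first edge of a path leaving `c` spans a larger set without cut-vertex. This prevents `{c}`
from being a block of either side, where it would spoil the disjoint decomposition of blocks. -/
theorem not_isBlockOf_singleton [DecidableEq V] {S : Finset V} {c : V}
    (hS : StronglyConnectedOn G S)
    (hc : c ∈ S) (hne : S ≠ {c}) : ¬ IsBlockOf G S {c} := by
  intro h
  obtain ⟨x, hx, hxc⟩ : ∃ x ∈ S, x ≠ c := by
    by_contra! hcon
    exact hne (Finset.eq_singleton_iff_unique_mem.2 ⟨hc, hcon⟩)
  obtain ⟨l, ⟨h1, h2, h3, h4⟩, h5⟩ := hS.2 c hc x hx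
  obtain ⟨q, rfl⟩ := List.head?_eq_some_iff.1 h1
  cases q with
  | nil => exact hxc (by simpa using h2.symm)
  | cons v q =>
    have hcv : c ≠ v := by
      rintro rfl
      simp at h4
    have hadj : G.toSimpleGraphInclusive.Adj c v := ⟨hcv, Or.inl (List.isChain_cons_cons.1 h3).1⟩
    have hsub : ({c, v} : Finset V) ⊆ S := by
      intro w hw
      rcases Finset.mem_insert.1 hw with rfl | hw
      · exact hc
      · rw [Finset.mem_singleton.1 hw]
        exact h5 v (by simp)
    have := h.2 ⟨connectedNoCutVertex_pair hadj, hsub⟩ (by simp)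
      (show v ∈ ({c, v} : Finset V) by simp)
    exact hcv (Finset.mem_singleton.1 this).symm

/-- A block of `S₁` contained in `S₂` would be `{c}`. So any larger candidate in the union must lie
in `S₁`, and maximality carries over. -/
theorem IsSeparation.isBlockOf_of_left [DecidableEq V] {S₁ S₂ B : Finset V} {c : V}
    (h : IsSeparation G S₁ S₂ c)
    (hS : StronglyConnectedOn G (S₁ ∪ S₂)) (hne : S₁ ≠ {c}) (hB : IsBlockOf G S₁ B) :
    IsBlockOf G (S₁ ∪ S₂) B ∧ ¬ B ⊆ S₂ := by
  have hB₂ : ¬ B ⊆ S₂ := by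
    intro hB₂
    obtain ⟨⟨v, hv⟩⟩ := hB.1.1.1.nonempty
    have : B = {c} := Finset.eq_singleton_iff_nonempty_unique_mem.2
      ⟨⟨v, hv⟩, fun w hw => h.eq_of_mem w (hB.1.2 hw) (hB₂ hw)⟩
    exact not_isBlockOf_singleton (h.stronglyConnectedOn_left hS) h.mem_left hne (this ▸ hB)
  refine ⟨⟨⟨hB.1.1, hB.1.2.trans Finset.subset_union_left⟩, fun B' hB' hBB' => ?_⟩, hB₂⟩
  rcases h.subset_or_subset hB'.1 hB'.2 with h' | h'
  · exact hB.2 ⟨hB'.1, h'⟩ hBB'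
  · exact absurd (hBB'.trans h') hB₂

theorem IsBlockOf.mono {S T B : Finset V} (hB : IsBlockOf G T B) (hST : S ⊆ T) (hBS : B ⊆ S) :
    IsBlockOf G S B :=
  ⟨⟨hB.1.1, hBS⟩, fun _ hB' hBB' => hB.2 ⟨hB'.1, hB'.2.trans hST⟩ hBB'⟩

variable [Fintype V]

open scoped Classical in
variable (G) in
/-- The vertex sets of the blocks of the subgraph induced on `S`. -/
noncomputable def blocksOf (S : Finset V) : Finset (Finset V) :=
  Finset.univ.filter (IsBlockOf G S)

theorem mem_blocksOf {S B : Finset V} : B ∈ blocksOf G S ↔ IsBlockOf G S B := by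
  simp [blocksOf]

theorem blocksOf_univ : blocksOf G Finset.univ = blocks G := by
  ext B
  simp [blocksOf, blocks, IsBlockOf, IsBlock]

theorem blocksOf_eq_singleton {S : Finset V} (hS : ConnectedNoCutVertex G S) :
    blocksOf G S = {S} := by
  ext B
  rw [mem_blocksOf, Finset.mem_singleton]
  refine ⟨fun hB => ?_, ?_⟩
  · exact Finset.Subset.antisymm hB.1.2 (hB.2 ⟨hS, subset_rfl⟩ hB.1.2)
  · rintro rfl
    exact ⟨⟨hS, subset_rfl⟩, fun B' hB' _ => hB'.2⟩

theorem IsSeparation.blocksOf_union [DecidableEq V] {S₁ S₂ : Finset V} {c : V}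
    (h : IsSeparation G S₁ S₂ c)
    (hS : StronglyConnectedOn G (S₁ ∪ S₂)) (hne₁ : S₁ ≠ {c}) (hne₂ : S₂ ≠ {c}) :
    blocksOf G (S₁ ∪ S₂) = blocksOf G S₁ ∪ blocksOf G S₂ := by
  ext B
  rw [Finset.mem_union, mem_blocksOf, mem_blocksOf, mem_blocksOf]
  refine ⟨fun hB => ?_, ?_⟩
  · exact (h.subset_or_subset hB.1.1 hB.1.2).imp (hB.mono Finset.subset_union_left)
      (hB.mono Finset.subset_union_right)
  · rintro (hB | hB)
    · exact (h.isBlockOf_of_left hS hne₁ hB).1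
    · rw [Finset.union_comm] at hS ⊢
      exact (h.symm.isBlockOf_of_left hS hne₂ hB).1

theorem IsSeparation.disjoint_blocksOf [DecidableEq V] {S₁ S₂ : Finset V} {c : V}
    (h : IsSeparation G S₁ S₂ c)
    (hS : StronglyConnectedOn G (S₁ ∪ S₂)) (hne₁ : S₁ ≠ {c}) :
    Disjoint (blocksOf G S₁) (blocksOf G S₂) := by
  rw [Finset.disjoint_left]
  intro B hB₁ hB₂
  exact (h.isBlockOf_of_left hS hne₁ (mem_blocksOf.1 hB₁)).2 (mem_blocksOf.1 hB₂).1.2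

/-- The theorem of Graham, Hoffman and Hosoya for weighted digraphs: the cofactor sum of the
distance matrix is the product of those of the blocks, and the quotient of determinant by cofactor
sum is additive over blocks. -/
theorem StronglyConnectedOn.cof_det_blockMatrix [DecidableEq V] {S : Finset V}
    (hS : StronglyConnectedOn G S)
    (hcof : ∀ B ∈ blocksOf G S, cof (blockMatrix G W B) ≠ 0) :
    cof (blockMatrix G W S) = ∏ B ∈ blocksOf G S, cof (blockMatrix G W B) ∧
      (blockMatrix G W S).det =
        (∑ B ∈ blocksOf G S, (blockMatrix G W B).det / cof (blockMatrix G W B)) *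
          ∏ B ∈ blocksOf G S, cof (blockMatrix G W B) := by
  induction S using Finset.strongInduction with
  | H S ih =>
    by_cases hB : ConnectedNoCutVertex G S
    -- Nonvanishing serves here to cancel `det / cof * cof`; the inductive step is a ring identity
    -- in the sums and products over the two sides.
    · rw [blocksOf_eq_singleton hB] at hcof ⊢
      have := hcof S (Finset.mem_singleton_self S)
      simp [this]
    · obtain ⟨S₁, S₂, c, h, rfl, h₁, h₂, hne₁, hne₂⟩ := exists_isSeparation hS hB
      rw [h.blocksOf_union hS hne₁ hne₂] at hcof ⊢
      have ih₁ := ih S₁ h₁ (h.stronglyConnectedOn_left hS) fun B hB =>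
        hcof B (Finset.mem_union_left _ hB)
      have ih₂ := ih S₂ h₂ (h.stronglyConnectedOn_right hS) fun B hB =>
        hcof B (Finset.mem_union_right _ hB)
      have hdisj := h.disjoint_blocksOf hS hne₁
      obtain ⟨hc, hd⟩ := h.cof_det_blockMatrix (W := W) hS
      rw [Finset.prod_union hdisj, Finset.sum_union hdisj, hc, hd, ih₁.2, ih₂.2, ih₁.1, ih₂.1]
      exact ⟨rfl, by ring⟩

theorem StronglyConnected.stronglyConnectedOn_univ (hG : StronglyConnected G) :
    StronglyConnectedOn G Finset.univ := by
  obtain ⟨hne, hG⟩ := hG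
  refine ⟨Finset.univ_nonempty, fun x _ y _ => ?_⟩
  obtain ⟨l, hl⟩ := hG x y
  exact ⟨l, hl, fun v _ => Finset.mem_univ v⟩

theorem distMatrix_eq_submatrix_blockMatrix :
    distMatrix G W = (blockMatrix G W Finset.univ).submatrix
      (Equiv.subtypeUnivEquiv Finset.mem_univ).symm
      (Equiv.subtypeUnivEquiv Finset.mem_univ).symm := by
  ext x y
  rw [submatrix_apply, blockMatrix_apply]
  simp [distMatrix, pathWeights, IsPathIn, Equiv.subtypeUnivEquiv]

end Blocks

end Cactoid

theorem mainTheorem4 {V : Type*} [Fintype V] [DecidableEq V] (G : Digraph V)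
    (hG : Cactoid.IsCactoidType G) (W : V → V → ℝ)
    (hcof : ∀ B ∈ Cactoid.blocks G, Cactoid.cof (Cactoid.blockMatrix G W B) ≠ 0) :
    (Cactoid.distMatrix G W).det =
        Cactoid.lam G W * ∏ B ∈ Cactoid.blocks G, Cactoid.cof (Cactoid.blockMatrix G W B) ∧
      Cactoid.lam G W * ∏ B ∈ Cactoid.blocks G, Cactoid.cof (Cactoid.blockMatrix G W B) =
        Cactoid.lam G W * Cactoid.cof (Cactoid.distMatrix G W) := by
  rw [← Cactoid.blocksOf_univ] at hcof
  obtain ⟨hc, hd⟩ := hG.1.stronglyConnectedOn_univ.cof_det_blockMatrix hcof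
  rw [Cactoid.blocksOf_univ] at hc hd
  rw [Cactoid.distMatrix_eq_submatrix_blockMatrix, Matrix.det_submatrix_equiv_self,
    Cactoid.cof_submatrix_equiv, hc, hd]
  exact ⟨rfl, rfl⟩
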